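/- Let $n\ge 1$, let $E=(C_2)^n=\prod_{i=1}^n\langle\sigma_i\rangle$, and let $\mathbb F_2E$ be its group algebra; put $\rho_i=\sigma_i-1$ and let $\mathbb F_2$ denote the trivial module. Let $P=\bigoplus_{i=1}^n \mathbb F_2E\,a_i$ be the free $\mathbb F_2E$-module on $a_1,\dots,a_n$, let $\psi\colon P\to\mathbb F_2E$ be the $\mathbb F_2E$-linear map with $\psi(a_i)=\rho_i$, and let $\epsilon\colon \mathbb F_2E\to\mathbb F_2$ be the augmentation. Then $P\xrightarrow{\psi}\mathbb F_2E\xrightarrow{\epsilon}\mathbb F_2\to 0$ is exact and $\Omega^2\mathbb F_2:=\ker\psi$ has no nonzero projective direct summand. Moreover: (1) $\operatorname{Ext}^1_{\mathbb F_2E}(\mathbb F_2,\Omega^2\mathbb F_2)\cong\mathbb F_2$. (2) The element $a=\rho_n\rho_{n-1}\cdots\rho_2a_1\in P$ (so $a=a_1$ if $n=1$) does not lie in $\Omega^2\mathbb F_2$; the $\mathbb F_2$-subspace $M=\Omega^2\mathbb F_2+\mathbb F_2a$ is an $\mathbb F_2E$-submodule of $P$; and there is an $\mathbb F_2E$-linear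 map $\eta\colon M\to\mathbb F_2$ with $\eta(\Omega^2\mathbb F_2)=0$ and $\eta(a)=1$. (3) The sequence $$0\to\Omega^2\mathbb F_2\xrightarrow{\ \subseteq\ }M\xrightarrow{\ \eta\ }\mathbb F_2\to0$$ is the Auslander–Reiten sequence ending in $\mathbb F_2$. That is, it is exact and does not split; every $\mathbb F_2E$-linear map $\Omega^2\mathbb F_2\to M'$ that is not a split monomorphism extends to $M$; every $\mathbb F_2E$-linear map $N'\to\mathbb F_2$ that is not a split epimorphism factors through $\eta$ (here $M'$ and $N'$ are arbitrary $\mathbb F_2E$-modules); and every short exact sequence of $\mathbb F_2E$-modules ending in $\mathbb F_2$ with these properties is isomorphic to it, by an isomorphism of short exact sequences that is the identity on $\mathbb F_2$. -/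

import Mathlib

open CategoryTheory

universe u r v₁ v₂ v₃

/-- A pair of composable linear maps `0 → M → E → N → 0` is an Auslander–Reiten (almost split)
sequence of `R`-modules: it is a short exact sequence, it does not split, the first map is left
almost split and the second map is right almost split. The test modules range over all
`R`-modules in the universe `u`. -/
structure IsAuslanderReitenSequence {R : Type r} [Ring R]
    {M : Type v₁} {E : Type v₂} {N : Type v₃}
    [AddCommGroup M] [Module R M] [AddCommGroup E] [Module R E] [AddCommGroup N] [Module R N]
    (α : M →ₗ[R] E) (β : E →ₗ[R] N) : Prop where
  injective : Function.Injective α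
  exact : Function.Exact α β
  surjective : Function.Surjective β
  /-- the sequence does not split -/
  not_split : ¬ ∃ s : N →ₗ[R] E, β ∘ₗ s = LinearMap.id
  /-- every map out of `M` that is not a split monomorphism factors through `α` -/
  left_almost_split : ∀ (M' : Type u) [AddCommGroup M'] [Module R M'] (φ : M →ₗ[R] M'),
    (¬ ∃ r : M' →ₗ[R] M, r ∘ₗ φ = LinearMap.id) → ∃ φ' : E →ₗ[R] M', φ' ∘ₗ α = φ
  /-- every map into `N` that is not a split epimorphism factors through `β` -/
  right_almost_split : ∀ (N' : Type u) [AddCommGroup N'] [Module R N'] (ψ : N' →ₗ[R] N),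
    (¬ ∃ s : N →ₗ[R] N', ψ ∘ₗ s = LinearMap.id) → ∃ ψ' : N' →ₗ[R] E, β ∘ₗ ψ' = ψ

namespace ElemAbelian

/-- The elementary abelian group `E = (C_2)^n`, written multiplicatively. -/
abbrev E (n : ℕ) : Type := Fin n → Multiplicative (ZMod 2)

/-- The group algebra `𝔽₂E`. -/
abbrev GroupAlg (n : ℕ) : Type := MonoidAlgebra (ZMod 2) (E n)

/-- The trivial `𝔽₂E`-module `𝔽₂`. -/
abbrev TrivF2 (n : ℕ) : Type := (Representation.trivial (ZMod 2) (E n) (ZMod 2)).asModule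

/-- The element `1` of the trivial module `𝔽₂`. -/
def one (n : ℕ) : TrivF2 n :=
  (Representation.trivial (ZMod 2) (E n) (ZMod 2)).asModuleEquiv.symm 1

/-- The generator `σ_i` of the `i`-th factor of `E`. -/
def σ {n : ℕ} (i : Fin n) : E n := Pi.mulSingle i (Multiplicative.ofAdd 1)

/-- `ρ_i = σ_i - 1` in the group algebra. -/
noncomputable def ρ {n : ℕ} (i : Fin n) : GroupAlg n := MonoidAlgebra.of (ZMod 2) (E n) (σ i) - 1

/-- The augmentation `ε : 𝔽₂E → 𝔽₂`, the `𝔽₂E`-linear map with `ε 1 = 1` (so `ε g = 1` for all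
`g` in `E`). -/
noncomputable def augmentation (n : ℕ) : GroupAlg n →ₗ[GroupAlg n] TrivF2 n :=
  LinearMap.toSpanSingleton (GroupAlg n) (TrivF2 n) (one n)

/-- The free module `P` of rank `n`. -/
abbrev P (n : ℕ) : Type := Fin n → GroupAlg n

/-- The basis element `a_i` of `P`. -/
noncomputable def gen {n : ℕ} (i : Fin n) : P n := Pi.single i 1

/-- The `𝔽₂E`-linear map `ψ : P → 𝔽₂E` with `ψ a_i = ρ_i`. -/
noncomputable def ψ (n : ℕ) : P n →ₗ[GroupAlg n] GroupAlg n :=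
  Fintype.linearCombination (GroupAlg n) (fun i : Fin n => (ρ i : GroupAlg n))

/-- `Ω² 𝔽₂ = ker ψ`, a submodule of `P`. -/
noncomputable def Omega2 (n : ℕ) : Submodule (GroupAlg n) (P n) := LinearMap.ker (ψ n)

/-- The element `a = ρ_n ⋯ ρ_2 a_1` of `P`; indices in `Fin n` start at `0`, so that `a_1` is
`gen 0` and `ρ_2, …, ρ_n` are the `ρ i` with `i ≠ 0`. -/
noncomputable def a (n : ℕ) [NeZero n] : P n :=
  (∏ i ∈ Finset.univ.erase (0 : Fin n), (ρ i : GroupAlg n)) • gen (0 : Fin n)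

end ElemAbelian

/-! Write `A` for the group algebra, `J` for its augmentation ideal and `s` for the product of all
`ρ i`. `A` is self-injective, `J` is nilpotent, the socle of `A` is the line spanned by `s`, and `ψ
a = s`. So `Ω² + 𝔽₂a` is the preimage under `ψ` of the socle, and `η` is `ψ` followed by the
identification of the socle with `𝔽₂`.

A map `w : Xⁿ → A` gives `toP w : X → P` with `ψ (toP w x) = w (ρ₁x, …, ρₙx)` (`ψ_toP`). For the
right almost split property, `φ : X → 𝔽₂` is not split epi exactly when it kills every `x` with all
`ρᵢx = 0`. By self-injectivity it then factors as a map `w` of `(ρᵢx)ᵢ`, and `toP w` is the lift.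

For the left one, `φ : Ω² → X` extends over `a` as soon as `y = (φ(ρᵢa))ᵢ` has the form `(ρᵢz)ᵢ`. If
it does not, some `w` vanishes on all `(ρᵢz)ᵢ` and has `w y = s`, so `t = toP w` maps `X` to `Ω²`.
Then `t ∘ φ` induces on `im ψ` multiplication by some `c` with `c s = s`. So `c` is a unit, `t ∘ φ`
is bijective (`injective_of_aug_eq_one`) and `φ` splits.

Uniqueness is the standard comparison of almost split sequences. `Ext¹` is the image of `Hom(𝔽₂, im
ψ)`, the socle of `A`, under a connecting map. -/

theorem LinearMap.exists_comp_eq_of_surjective {R X Y Z : Type*} [Ring R]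
    [AddCommGroup X] [Module R X] [AddCommGroup Y] [Module R Y] [AddCommGroup Z] [Module R Z]
    (p : X →ₗ[R] Y) (hp : Function.Surjective p) (q : X →ₗ[R] Z)
    (h : LinearMap.ker p ≤ LinearMap.ker q) : ∃ q' : Y →ₗ[R] Z, ∀ x, q' (p x) = q x := by
  refine ⟨(LinearMap.ker p).liftQ q h ∘ₗ (p.quotKerEquivOfSurjective hp).symm.toLinearMap,
    fun x ↦ ?_⟩
  have : (p.quotKerEquivOfSurjective hp).symm (p x) = Submodule.Quotient.mk x := by
    rw [LinearEquiv.symm_apply_eq]; rfl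
  simp [this]

/-! ### Self-injectivity of group algebras of finite groups -/

/-- The `k[G]`-linear map into `k[G]` whose coefficient at `1` is a given linear functional. -/
noncomputable def MonoidAlgebra.ofFunctional {k G X : Type*} [Field k] [Group G] [Fintype G]
    [AddCommGroup X] [Module k X] [Module (MonoidAlgebra k G) X]
    [IsScalarTower k (MonoidAlgebra k G) X] (l : X →ₗ[k] k) :
    X →ₗ[MonoidAlgebra k G] MonoidAlgebra k G :=
  MonoidAlgebra.equivariantOfLinearOfComm
    { toFun := fun v ↦ ∑ g : G, MonoidAlgebra.single g
        (l (MonoidAlgebra.single g⁻¹ (1 : k) • v))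
      map_add' := fun v w ↦ by simp [Finset.sum_add_distrib, MonoidAlgebra.single_add]
      map_smul' := fun c v ↦ by
        have : ∀ g : G, MonoidAlgebra.single g (1 : k) • c • v =
            c • MonoidAlgebra.single g (1 : k) • v := fun g ↦ by
          rw [← smul_assoc c, ← algebraMap_smul (MonoidAlgebra k G) c v, smul_smul,
            ← Algebra.commutes, Algebra.smul_def]
        simp [this, Finset.smul_sum] }
    (fun h v ↦ by
      simp only [LinearMap.coe_mk, AddHom.coe_mk, smul_smul, MonoidAlgebra.single_mul_single,
        mul_one, smul_eq_mul, Finset.mul_sum]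
      refine Fintype.sum_equiv (Equiv.mulLeft h⁻¹) _ _ fun g ↦ ?_
      simp)

theorem MonoidAlgebra.ofFunctional_coeff_one {k G X : Type*} [Field k] [Group G] [Fintype G]
    [AddCommGroup X] [Module k X] [Module (MonoidAlgebra k G) X]
    [IsScalarTower k (MonoidAlgebra k G) X] (l : X →ₗ[k] k) (v : X) :
    (MonoidAlgebra.ofFunctional (G := G) l v).coeff 1 = l v := by
  classical
  change (∑ g : G, MonoidAlgebra.single g (l (MonoidAlgebra.single g⁻¹ (1 : k) • v))).coeff 1 = _
  simp [MonoidAlgebra.coeff_sum, Finsupp.finsetSum_apply, Finsupp.single_apply,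
    ← MonoidAlgebra.one_def]

/-- A `k[G]`-linear map into `k[G]` is determined by the coefficient at `1`. -/
theorem MonoidAlgebra.linearMap_ext_coeff_one {k G X : Type*} [Field k] [Group G]
    [AddCommGroup X] [Module (MonoidAlgebra k G) X]
    {f f' : X →ₗ[MonoidAlgebra k G] MonoidAlgebra k G}
    (h : ∀ x, (f x).coeff 1 = (f' x).coeff 1) : f = f' := by
  ext x g
  have := h (MonoidAlgebra.single g⁻¹ (1 : k) • x)
  simpa [MonoidAlgebra.coeff_single_mul_apply] using this

/-- The group algebra of a finite group over a field is self-injective. -/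
theorem MonoidAlgebra.exists_comp_eq_of_ker_le {k G X Y : Type*} [Field k] [Group G] [Finite G]
    [AddCommGroup X] [Module (MonoidAlgebra k G) X] [AddCommGroup Y] [Module (MonoidAlgebra k G) Y]
    (f : X →ₗ[MonoidAlgebra k G] Y) (q : X →ₗ[MonoidAlgebra k G] MonoidAlgebra k G)
    (h : LinearMap.ker f ≤ LinearMap.ker q) :
    ∃ w : Y →ₗ[MonoidAlgebra k G] MonoidAlgebra k G, ∀ x, w (f x) = q x := by
  have := Fintype.ofFinite G
  let : Module k X := Module.compHom X (algebraMap k (MonoidAlgebra k G))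
  have : IsScalarTower k (MonoidAlgebra k G) X := ⟨fun c a x ↦ by
    rw [Algebra.smul_def, mul_smul]; rfl⟩
  let : Module k Y := Module.compHom Y (algebraMap k (MonoidAlgebra k G))
  have : IsScalarTower k (MonoidAlgebra k G) Y := ⟨fun c a x ↦ by
    rw [Algebra.smul_def, mul_smul]; rfl⟩
  let c : MonoidAlgebra k G →ₗ[k] k :=
    { toFun := fun a ↦ a.coeff 1, map_add' := by simp, map_smul' := by simp }
  -- Only the functional "coefficient of `q` at `1`" has to be factored through `f`. It descends to
  -- the range of `f` through the `k`-linear section `s` and extends to `Y` because `k` is a field.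
  let l : X →ₗ[k] k := c ∘ₗ q.restrictScalars k
  obtain ⟨s, hs⟩ := ((f.restrictScalars k).rangeRestrict).exists_rightInverse_of_surjective
    (LinearMap.range_rangeRestrict _)
  obtain ⟨m, hm⟩ := LinearMap.exists_extend (l ∘ₗ s)
  refine ⟨MonoidAlgebra.ofFunctional m, fun x ↦ ?_⟩
  suffices MonoidAlgebra.ofFunctional m ∘ₗ f = q from LinearMap.congr_fun this x
  refine MonoidAlgebra.linearMap_ext_coeff_one fun x ↦ ?_
  rw [LinearMap.comp_apply, MonoidAlgebra.ofFunctional_coeff_one]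
  have h1 := LinearMap.congr_fun hm ((f.restrictScalars k).rangeRestrict x)
  have h2 := congrArg Subtype.val
    (LinearMap.congr_fun hs ((f.restrictScalars k).rangeRestrict x))
  have h3 : q (s ((f.restrictScalars k).rangeRestrict x)) = q x := by
    rw [← sub_eq_zero, ← map_sub]
    refine h ?_
    rw [LinearMap.mem_ker, map_sub, sub_eq_zero]
    exact h2
  calc m (f x) = (q (s ((f.restrictScalars k).rangeRestrict x))).coeff 1 := h1
    _ = _ := by rw [h3]

/-! ### Augmentation ideal and socle of `𝔽₂E` -/

namespace ElemAbelian

variable {n : ℕ}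

/-- The augmentation of `𝔽₂E` as an algebra homomorphism. -/
noncomputable def aug (n : ℕ) : GroupAlg n →ₐ[ZMod 2] ZMod 2 :=
  MonoidAlgebra.lift (ZMod 2) (ZMod 2) (E n) 1

theorem aug_of (g : E n) : aug n (MonoidAlgebra.of (ZMod 2) (E n) g) = 1 := by
  simp [aug]

theorem aug_ρ (i : Fin n) : aug n (ρ i) = 0 := by
  rw [ρ, map_sub, aug_of, map_one, sub_self]

theorem σ_mul_self (i : Fin n) : σ i * σ i = (1 : E n) := by
  rw [σ, ← Pi.mulSingle_mul]
  have : Multiplicative.ofAdd (1 : ZMod 2) * Multiplicative.ofAdd 1 = 1 := by decide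
  rw [this, Pi.mulSingle_one]

instance charP_groupAlg : CharP (GroupAlg n) 2 :=
  charP_of_injective_algebraMap (FaithfulSMul.algebraMap_injective (ZMod 2) _) 2

/-- Squaring is additive in characteristic 2 and sends every group element to `1`. -/
theorem sq_eq_aug (x : GroupAlg n) : x * x = algebraMap (ZMod 2) (GroupAlg n) (aug n x) := by
  induction x using MonoidAlgebra.induction_on with
  | of g =>
    rw [aug_of, map_one, ← map_mul]
    have : g * g = 1 := by
      funext i
      exact (by decide : ∀ y : Multiplicative (ZMod 2), y * y = 1) (g i)
    rw [this, map_one]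
  | add x y hx hy =>
    rw [CharTwo.add_mul_self, hx, hy, map_add, map_add]
  | smul r x hx =>
    rw [smul_mul_smul_comm, hx, map_smul, smul_eq_mul, map_mul, Algebra.smul_def]
    congr 2
    revert r; decide

theorem ρ_mul_self (i : Fin n) : (ρ i : GroupAlg n) * ρ i = 0 := by
  rw [sq_eq_aug, aug_ρ, map_zero]

/-- The augmentation ideal is generated by the `ρ i`. -/
theorem sub_aug_mem_span (x : GroupAlg n) :
    x - algebraMap (ZMod 2) (GroupAlg n) (aug n x) ∈
      Ideal.span (Set.range (ρ : Fin n → GroupAlg n)) := by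
  induction x using MonoidAlgebra.induction_on with
  | of g =>
    rw [aug_of, map_one]
    set J := Ideal.span (Set.range (ρ : Fin n → GroupAlg n))
    -- Modulo `J` every `σ i` becomes `1`, so the homomorphism from `E` to the quotient is trivial
    -- on each factor.
    let q : E n →* (GroupAlg n ⧸ J) :=
      ((Ideal.Quotient.mk J : GroupAlg n →* GroupAlg n ⧸ J)).comp (MonoidAlgebra.of (ZMod 2) (E n))
    suffices q = 1 by
      rw [← Ideal.Quotient.mk_eq_mk_iff_sub_mem, map_one]
      exact DFunLike.congr_fun this g
    refine MonoidHom.pi_ext fun i y ↦ ?_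
    rcases (by decide : ∀ y : Multiplicative (ZMod 2), y = 1 ∨ y = Multiplicative.ofAdd 1) y
      with rfl | rfl
    · simp
    · change Ideal.Quotient.mk J (MonoidAlgebra.of (ZMod 2) (E n) (σ i)) = 1
      rw [← map_one (Ideal.Quotient.mk J), Ideal.Quotient.mk_eq_mk_iff_sub_mem]
      exact Ideal.subset_span ⟨i, rfl⟩
  | add x y hx hy =>
    have := add_mem hx hy
    rw [map_add, map_add]
    convert this using 1
    ring
  | smul r x hx =>
    rw [map_smul, smul_eq_mul, map_mul, Algebra.smul_def, ← mul_sub]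
    exact Ideal.mul_mem_left _ _ hx

theorem mem_span_ρ_iff {x : GroupAlg n} :
    x ∈ Ideal.span (Set.range (ρ : Fin n → GroupAlg n)) ↔ aug n x = 0 := by
  refine ⟨fun h ↦ ?_, fun h ↦ by simpa [h] using sub_aug_mem_span x⟩
  have : Ideal.span (Set.range (ρ : Fin n → GroupAlg n)) ≤ RingHom.ker (aug n) := by
    rw [Ideal.span_le]
    rintro _ ⟨i, rfl⟩
    exact aug_ρ i
  exact this h

/-- An element killed by all the `ρ i` is killed by the augmentation ideal. -/
theorem smul_eq_zero_of_aug {X : Type*} [AddCommGroup X] [Module (GroupAlg n) X] {x : X}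
    (hx : ∀ i : Fin n, (ρ i : GroupAlg n) • x = 0) {c : GroupAlg n} (hc : aug n c = 0) :
    c • x = 0 := by
  have : Ideal.span (Set.range (ρ : Fin n → GroupAlg n)) ≤
      LinearMap.ker (LinearMap.toSpanSingleton (GroupAlg n) X x) := by
    rw [Ideal.span_le]
    rintro _ ⟨i, rfl⟩
    simpa using hx i
  simpa using this (mem_span_ρ_iff.2 hc)

theorem smul_eq_aug_smul {X : Type*} [AddCommGroup X] [Module (GroupAlg n) X] {x : X}
    (hx : ∀ i : Fin n, (ρ i : GroupAlg n) • x = 0) (c : GroupAlg n) :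
    c • x = algebraMap (ZMod 2) (GroupAlg n) (aug n c) • x := by
  rw [← sub_eq_zero, ← sub_smul]
  exact smul_eq_zero_of_aug hx (by
    rw [map_sub, AlgHom.commutes, Algebra.algebraMap_self_apply, sub_self])

theorem smul_eq_self_of_aug {X : Type*} [AddCommGroup X] [Module (GroupAlg n) X] {x : X}
    (hx : ∀ i : Fin n, (ρ i : GroupAlg n) • x = 0) {c : GroupAlg n} (hc : aug n c = 1) :
    c • x = x := by
  rw [smul_eq_aug_smul hx, hc, map_one, one_smul]

theorem aug_eq_zero_or_one (c : GroupAlg n) : aug n c = 0 ∨ aug n c = 1 :=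
  (by decide : ∀ y : ZMod 2, y = 0 ∨ y = 1) _

/-- The product is the sum of all elements of the subgroup generated by the `σ i` with `i ∈ T`. -/
theorem prod_ρ_coeff (T : Finset (Fin n)) (h : E n) :
    (∏ i ∈ T, (ρ i : GroupAlg n)).coeff h = if ∀ i ∉ T, h i = 1 then 1 else 0 := by
  classical
  induction T using Finset.induction_on generalizing h with
  | empty =>
    simp [MonoidAlgebra.one_def, Finsupp.single_apply, funext_iff, eq_comm]
  | insert j T hj ih =>
    rw [Finset.prod_insert hj, ρ, sub_mul, one_mul, MonoidAlgebra.coeff_sub, Finsupp.sub_apply,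
      MonoidAlgebra.of_apply, MonoidAlgebra.coeff_single_mul_apply, one_mul, ih, ih,
      inv_eq_of_mul_eq_one_left (σ_mul_self j)]
    have key : ∀ g : E n, (∀ i ∉ T, g i = 1) ↔ (∀ i ∉ insert j T, g i = 1) ∧ g j = 1 := by
      intro g
      constructor
      · exact fun H ↦ ⟨fun i hi ↦ H i fun h' ↦ hi (Finset.mem_insert_of_mem h'), H j hj⟩
      · rintro ⟨H, H'⟩ i hi
        by_cases hij : i = j
        · rw [hij, H']
        · exact H i (by simp [hij, hi])
    have key' : (∀ i ∉ insert j T, (σ j * h) i = 1) ↔ (∀ i ∉ insert j T, h i = 1) := by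
      refine forall₂_congr fun i hi ↦ ?_
      have : i ≠ j := fun h' ↦ hi (h' ▸ Finset.mem_insert_self _ _)
      simp [σ, this]
    simp only [key, key']
    have hσ : (σ j * h) j = Multiplicative.ofAdd 1 * h j := by simp [σ]
    rw [hσ]
    by_cases H : ∀ i ∉ insert j T, h i = 1
    · simp only [eq_true H, true_and, if_true]
      generalize h j = y
      revert y
      decide
    · simp only [eq_false H, false_and, if_false, sub_zero]

/-- The socle element `∏ ρ_i` of the group algebra. -/
noncomputable def socle (n : ℕ) : GroupAlg n := ∏ i : Fin n, (ρ i : GroupAlg n)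

theorem socle_coeff (g : E n) : (socle n).coeff g = 1 := by
  simp [socle, prod_ρ_coeff]

theorem socle_ne_zero : socle n ≠ 0 := fun h ↦ by
  have := socle_coeff (1 : E n)
  simp [h] at this

theorem ρ_smul_socle (i : Fin n) : (ρ i : GroupAlg n) • socle n = 0 := by
  rw [socle, ← Finset.mul_prod_erase _ _ (Finset.mem_univ i), smul_eq_mul, ← mul_assoc,
    ρ_mul_self, zero_mul]

theorem mul_socle_eq_zero_iff {c : GroupAlg n} : c * socle n = 0 ↔ aug n c = 0 := by
  refine ⟨fun h ↦ (aug_eq_zero_or_one c).resolve_right fun hc ↦ ?_,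
    fun h ↦ smul_eq_zero_of_aug ρ_smul_socle h⟩
  rw [← smul_eq_mul, smul_eq_self_of_aug ρ_smul_socle hc] at h
  exact socle_ne_zero h

/-- An element of `𝔽₂E` killed by all `ρ_i` has constant coefficients. -/
theorem coeff_eq_of_ρ_smul {x : GroupAlg n} (hx : ∀ i : Fin n, (ρ i : GroupAlg n) • x = 0)
    (g : E n) : x.coeff g = x.coeff 1 := by
  have := smul_eq_self_of_aug hx (aug_of g)
  conv_lhs => rw [← this]
  rw [MonoidAlgebra.of_apply, smul_eq_mul, MonoidAlgebra.coeff_single_mul_apply]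
  simp

end ElemAbelian

/-! ### Uniqueness of Auslander–Reiten sequences -/

namespace IsAuslanderReitenSequence

/-- A map of sequences over the identity of the right-hand term restricts to the left-hand terms. -/
theorem exists_restrict {R : Type*} [Ring R] {M₁ E₁ M₂ E₂ N : Type*}
    [AddCommGroup M₁] [Module R M₁] [AddCommGroup E₁] [Module R E₁]
    [AddCommGroup M₂] [Module R M₂] [AddCommGroup E₂] [Module R E₂] [AddCommGroup N] [Module R N]
    {α₁ : M₁ →ₗ[R] E₁} {β₁ : E₁ →ₗ[R] N} {α₂ : M₂ →ₗ[R] E₂} {β₂ : E₂ →ₗ[R] N}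
    (h₁ : Function.Exact α₁ β₁) (hα₂ : Function.Injective α₂) (h₂ : Function.Exact α₂ β₂)
    (g : E₁ →ₗ[R] E₂) (hg : β₂ ∘ₗ g = β₁) : ∃ f : M₁ →ₗ[R] M₂, g ∘ₗ α₁ = α₂ ∘ₗ f := by
  have hmem : ∀ x, (g ∘ₗ α₁) x ∈ LinearMap.range α₂ := fun x ↦ by
    refine (h₂ _).1 ?_
    rw [LinearMap.comp_apply, ← LinearMap.comp_apply, hg]
    exact h₁.apply_apply_eq_zero x
  refine ⟨(LinearEquiv.ofInjective α₂ hα₂).symm.toLinearMap ∘ₗ (g ∘ₗ α₁).codRestrict _ hmem, ?_⟩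
  ext x
  have := LinearEquiv.apply_symm_apply (LinearEquiv.ofInjective α₂ hα₂)
    ((g ∘ₗ α₁).codRestrict _ hmem x)
  exact (congrArg Subtype.val this).symm

/-- An endomorphism of an Auslander–Reiten sequence over the identity of the right-hand term is a
split monomorphism on the left-hand term. -/
theorem exists_retraction {R : Type r} [Ring R] {M : Type u} {E : Type v₂} {N : Type v₃}
    [AddCommGroup M] [Module R M] [AddCommGroup E] [Module R E] [AddCommGroup N] [Module R N]
    {α : M →ₗ[R] E} {β : E →ₗ[R] N} (h : IsAuslanderReitenSequence.{u} α β)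
    (g : E →ₗ[R] E) (hg : β ∘ₗ g = β) (f : M →ₗ[R] M) (hf : g ∘ₗ α = α ∘ₗ f) :
    ∃ s : M →ₗ[R] M, s ∘ₗ f = LinearMap.id := by
  -- Otherwise `f` extends to `t : E → M`. Then `g - α ∘ t` kills the image of `α`, and the map it
  -- induces on `N` is a section of `β`.
  by_contra hs
  obtain ⟨t, ht⟩ := h.left_almost_split M f hs
  obtain ⟨s, hs'⟩ := LinearMap.exists_comp_eq_of_surjective β h.surjective (g - α ∘ₗ t) (by
    intro x hx
    obtain ⟨m, rfl⟩ := (h.exact x).1 hx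
    have h1 := LinearMap.congr_fun hf m
    have h2 := LinearMap.congr_fun ht m
    simp only [LinearMap.comp_apply] at h1 h2
    simp [h1, h2])
  refine h.not_split ⟨s, ?_⟩
  ext y
  obtain ⟨x, rfl⟩ := h.surjective y
  have h1 := LinearMap.congr_fun hg x
  simp only [LinearMap.comp_apply] at h1
  simp [hs', h1, h.exact.apply_apply_eq_zero]

/-- An Auslander–Reiten sequence with finite left-hand term is determined by its right-hand term. -/
theorem exists_equiv {R : Type r} [Ring R] {M E : Type v₁} {N : Type v₃}
    {M' E' : Type u}
    [AddCommGroup M] [Module R M] [AddCommGroup E] [Module R E] [AddCommGroup N] [Module R N]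
    [AddCommGroup M'] [Module R M'] [AddCommGroup E'] [Module R E'] [Finite M]
    {α : M →ₗ[R] E} {β : E →ₗ[R] N} (h₀ : IsAuslanderReitenSequence.{v₁} α β)
    (h : IsAuslanderReitenSequence.{max u v₁} α β)
    {α' : M' →ₗ[R] E'} {β' : E' →ₗ[R] N} (h₀' : IsAuslanderReitenSequence.{u} α' β')
    (h' : IsAuslanderReitenSequence.{max u v₁} α' β') :
    ∃ (f : M ≃ₗ[R] M') (g : E ≃ₗ[R] E'),
      g.toLinearMap ∘ₗ α = α' ∘ₗ f.toLinearMap ∧ β' ∘ₗ g.toLinearMap = β := by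
  -- As `β` is not a split epimorphism, it lifts through `β'`; `ULift` only moves the test module
  -- into the right universe.
  obtain ⟨g, hg⟩ : ∃ g : E →ₗ[R] E', β' ∘ₗ g = β := by
    obtain ⟨g, hg⟩ := h'.right_almost_split (ULift.{u} E)
      (β ∘ₗ (ULift.moduleEquiv : ULift.{u} E ≃ₗ[R] E).toLinearMap) (by
        rintro ⟨s, hs⟩
        exact h.not_split ⟨(ULift.moduleEquiv : ULift.{u} E ≃ₗ[R] E).toLinearMap ∘ₗ s, hs⟩)
    refine ⟨g ∘ₗ (ULift.moduleEquiv : ULift.{u} E ≃ₗ[R] E).symm.toLinearMap, ?_⟩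
    rw [← LinearMap.comp_assoc, hg]
    rfl
  obtain ⟨k, hk⟩ : ∃ k : E' →ₗ[R] E, β ∘ₗ k = β' := by
    obtain ⟨k, hk⟩ := h.right_almost_split (ULift.{v₁} E')
      (β' ∘ₗ (ULift.moduleEquiv : ULift.{v₁} E' ≃ₗ[R] E').toLinearMap) (by
        rintro ⟨s, hs⟩
        exact h'.not_split ⟨(ULift.moduleEquiv : ULift.{v₁} E' ≃ₗ[R] E').toLinearMap ∘ₗ s, hs⟩)
    refine ⟨k ∘ₗ (ULift.moduleEquiv : ULift.{v₁} E' ≃ₗ[R] E').symm.toLinearMap, ?_⟩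
    rw [← LinearMap.comp_assoc, hk]
    rfl
  obtain ⟨f, hf⟩ := exists_restrict h.exact h'.injective h'.exact g hg
  obtain ⟨l, hl⟩ := exists_restrict h'.exact h.injective h.exact k hk
  obtain ⟨s, hs⟩ := h₀.exists_retraction (k ∘ₗ g) (by rw [← LinearMap.comp_assoc, hk, hg])
    (l ∘ₗ f) (by rw [LinearMap.comp_assoc, hf, ← LinearMap.comp_assoc, hl, LinearMap.comp_assoc])
  obtain ⟨s', hs'⟩ := h₀'.exists_retraction (g ∘ₗ k) (by rw [← LinearMap.comp_assoc, hg, hk])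
    (f ∘ₗ l) (by rw [LinearMap.comp_assoc, hl, ← LinearMap.comp_assoc, hf, LinearMap.comp_assoc])
  have hfinj : Function.Injective f := fun x y hxy ↦ by
    have hx := LinearMap.congr_fun hs x
    have hy := LinearMap.congr_fun hs y
    simp only [LinearMap.comp_apply, LinearMap.id_apply] at hx hy
    rw [← hx, ← hy, hxy]
  have hlinj : Function.Injective l := fun x y hxy ↦ by
    have hx := LinearMap.congr_fun hs' x
    have hy := LinearMap.congr_fun hs' y
    simp only [LinearMap.comp_apply, LinearMap.id_apply] at hx hy
    rw [← hx, ← hy, hxy]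
  -- `M'` embeds in the finite `M` through `l`, so the injective endomorphism `f ∘ l` of `M'` is
  -- onto.
  have hlf : Function.Surjective (f ∘ l) :=
    have := Finite.of_injective l hlinj
    Finite.surjective_of_injective (hfinj.comp hlinj)
  have hfsurj : Function.Surjective f := hlf.of_comp
  have hf' : ∀ x, g (α x) = α' (f x) := LinearMap.congr_fun hf
  have hg' : ∀ x, β' (g x) = β x := LinearMap.congr_fun hg
  have hgbij : Function.Bijective g := by
    constructor
    · rw [injective_iff_map_eq_zero]
      intro x hx
      obtain ⟨m, rfl⟩ := (h.exact x).1 (by rw [← hg', hx, map_zero])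
      rw [hf', map_eq_zero_iff _ h'.injective, map_eq_zero_iff _ hfinj] at hx
      rw [hx, map_zero]
    · intro y
      obtain ⟨x, hx⟩ := h.surjective (β' y)
      obtain ⟨m', hm'⟩ := (h'.exact (y - g x)).1 (by rw [map_sub, hg', hx, sub_self])
      obtain ⟨m, rfl⟩ := hfsurj m'
      exact ⟨α m + x, by rw [map_add, hf', hm', sub_add_cancel]⟩
  exact ⟨LinearEquiv.ofBijective f ⟨hfinj, hfsurj⟩, LinearEquiv.ofBijective g hgbij, hf, hg⟩

end IsAuslanderReitenSequence

/-! ### The sequence ending in the trivial module -/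

namespace ElemAbelian

variable {n : ℕ}

instance finite_groupAlg : Finite (GroupAlg n) :=
  Module.finite_of_finite (ZMod 2)

theorem ψ_apply (x : P n) : ψ n x = ∑ i, x i * ρ i := by
  simp [ψ, Fintype.linearCombination_apply]

theorem isNilpotent_span_ρ :
    IsNilpotent (Ideal.span (Set.range (ρ : Fin n → GroupAlg n))) := by
  rw [Ideal.FG.isNilpotent_iff_le_nilradical (Submodule.fg_span (Set.finite_range _))]
  intro x hx
  refine ⟨2, ?_⟩
  rw [sq, sq_eq_aug, mem_span_ρ_iff.1 hx, map_zero]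
  exact Submodule.zero_mem _

/-! ### The trivial module -/

theorem one_ne_zero : one n ≠ 0 := by
  intro h
  have := congrArg (Representation.trivial (ZMod 2) (E n) (ZMod 2)).asModuleEquiv h
  simp [one] at this

theorem eq_zero_or_one (x : TrivF2 n) : x = 0 ∨ x = one n :=
  (by decide : ∀ y : ZMod 2, y = 0 ∨ y = 1) x

theorem ρ_smul_triv (i : Fin n) (x : TrivF2 n) : (ρ i : GroupAlg n) • x = 0 := by
  rw [ρ, sub_smul, one_smul, sub_eq_zero]
  simp [MonoidAlgebra.of_apply]
  rfl

theorem smul_one_eq_zero_iff {c : GroupAlg n} : c • one n = 0 ↔ aug n c = 0 := by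
  refine ⟨fun h ↦ (aug_eq_zero_or_one c).resolve_right fun hc ↦ ?_,
    fun h ↦ smul_eq_zero_of_aug (fun i ↦ ρ_smul_triv i _) h⟩
  rw [smul_eq_self_of_aug (fun i ↦ ρ_smul_triv i _) hc] at h
  exact one_ne_zero h

theorem augmentation_surjective : Function.Surjective (augmentation n) := fun x ↦ by
  rcases eq_zero_or_one x with rfl | rfl
  · exact ⟨0, map_zero _⟩
  · exact ⟨1, by simp [augmentation]⟩

theorem exact_ψ_augmentation : Function.Exact (ψ n) (augmentation n) := fun x ↦ by
  rw [augmentation, LinearMap.toSpanSingleton_apply, smul_one_eq_zero_iff, ← mem_span_ρ_iff]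
  change x ∈ Submodule.span _ _ ↔ x ∈ LinearMap.range (ψ n)
  rw [ψ, Fintype.range_linearCombination]

theorem triv_linearMap_ext {X : Type*} [AddCommGroup X] [Module (GroupAlg n) X]
    {f g : TrivF2 n →ₗ[GroupAlg n] X} (h : f (one n) = g (one n)) : f = g := by
  apply LinearMap.ext
  intro x
  rcases eq_zero_or_one x with rfl | rfl
  · rw [map_zero, map_zero]
  · exact h

/-- `Hom(𝔽₂, X)` is the socle of `X`: an element killed by all `ρ i` is killed by the kernel of the
augmentation. -/
theorem exists_linearMap_triv {X : Type*} [AddCommGroup X] [Module (GroupAlg n) X] {x : X}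
    (hx : ∀ i : Fin n, (ρ i : GroupAlg n) • x = 0) :
    ∃ f : TrivF2 n →ₗ[GroupAlg n] X, f (one n) = x := by
  obtain ⟨f, hf⟩ := LinearMap.exists_comp_eq_of_surjective (augmentation n)
    augmentation_surjective (LinearMap.toSpanSingleton (GroupAlg n) X x) (fun c hc ↦ by
      rw [LinearMap.mem_ker, augmentation, LinearMap.toSpanSingleton_apply,
        smul_one_eq_zero_iff] at hc
      exact smul_eq_zero_of_aug hx hc)
  refine ⟨f, ?_⟩
  have := hf 1
  simpa [augmentation] using this

/-! ### The second syzygy -/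

/-- Multiply `∑ xᵢρᵢ = 0` by the product of the `ρᵢ` with `i ≠ j`. Since `ρᵢ² = 0`, only `xⱼ` times
the socle element survives. Thus `Ω² ⊆ JP`, the minimality of the presentation. -/
theorem aug_of_mem_Omega2 {x : P n} (hx : x ∈ Omega2 n) (j : Fin n) : aug n (x j) = 0 := by
  rw [← mul_socle_eq_zero_iff, socle, ← Finset.mul_prod_erase _ _ (Finset.mem_univ j),
    ← mul_assoc]
  have h : ∑ i, x i * ρ i = 0 := by rw [← ψ_apply]; exact hx
  have h2 := congrArg (· * ∏ i ∈ Finset.univ.erase j, (ρ i : GroupAlg n)) h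
  simp only [zero_mul, Finset.sum_mul] at h2
  rwa [Finset.sum_eq_single j (fun i _ hij ↦ ?_) (by simp)] at h2
  rw [mul_assoc, ← Finset.mul_prod_erase (Finset.univ.erase j) _
    (Finset.mem_erase.2 ⟨hij, Finset.mem_univ i⟩), ← mul_assoc (ρ i), ρ_mul_self, zero_mul,
    mul_zero]

theorem mem_Omega2_of_ρ_smul_eq_zero {x : P n}
    (hx : ∀ i : Fin n, (ρ i : GroupAlg n) • x = 0) : x ∈ Omega2 n := by
  rw [Omega2, LinearMap.mem_ker, ψ_apply]
  refine Finset.sum_eq_zero fun i _ ↦ ?_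
  rw [mul_comm]
  exact congrFun (hx i) i

/-- Self-injectivity is used twice: `f` extends to `P` coordinatewise, and since the extension
preserves `ker ψ`, it induces a map on `im ψ` that extends to `𝔽₂E`, where it is multiplication by
the image of `1`. -/
theorem exists_extension (f : Omega2 n →ₗ[GroupAlg n] Omega2 n) :
    ∃ (F : P n →ₗ[GroupAlg n] P n) (c : GroupAlg n),
      (∀ x : Omega2 n, F x = f x) ∧ ∀ x, ψ n (F x) = c * ψ n x := by
  choose w hw using fun i : Fin n ↦ MonoidAlgebra.exists_comp_eq_of_ker_le (Omega2 n).subtype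
    (LinearMap.proj i ∘ₗ (Omega2 n).subtype ∘ₗ f) (by simp)
  have hF : ∀ x : Omega2 n, LinearMap.pi w x = f x := fun x ↦ funext fun i ↦ hw i x
  obtain ⟨m, hm⟩ := MonoidAlgebra.exists_comp_eq_of_ker_le (ψ n) (ψ n ∘ₗ LinearMap.pi w)
    (fun x hx ↦ by
      rw [LinearMap.mem_ker, LinearMap.comp_apply, hF ⟨x, hx⟩]
      exact (f ⟨x, hx⟩).2)
  refine ⟨LinearMap.pi w, m 1, hF, fun x ↦ ?_⟩
  rw [← LinearMap.comp_apply, ← hm, mul_comm, ← smul_eq_mul, ← map_smul, smul_eq_mul, mul_one]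

/-- Here `c² = 1`, so `D = 1 - F²` maps `P` into `ker ψ ⊆ JP` and hence `JᵐP` into `Jᵐ⁺¹P`. If `f x
= 0` then `D x = x`, so `x` lies in every `JᵐP`, and `J` is nilpotent. -/
theorem injective_of_aug_eq_one {f : Omega2 n →ₗ[GroupAlg n] Omega2 n}
    {F : P n →ₗ[GroupAlg n] P n} {c : GroupAlg n} (hF : ∀ x : Omega2 n, F x = f x)
    (hc : ∀ x, ψ n (F x) = c * ψ n x) (h : aug n c = 1) : Function.Injective f := by
  rw [injective_iff_map_eq_zero]
  intro x hx
  let D : P n →ₗ[GroupAlg n] P n := LinearMap.id - F ∘ₗ F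
  have hD : ∀ y, D y ∈ Omega2 n := fun y ↦ by
    rw [Omega2, LinearMap.mem_ker, LinearMap.sub_apply, map_sub, LinearMap.comp_apply, hc, hc,
      ← mul_assoc, sq_eq_aug, h, map_one, one_mul, LinearMap.id_apply, sub_self]
  have hDx : D x = x := by
    simp [D, hF, hx]
  obtain ⟨k, hk⟩ := isNilpotent_span_ρ (n := n)
  have key : ∀ m : ℕ, ∀ j, (x : P n) j ∈ Ideal.span (Set.range (ρ : Fin n → GroupAlg n)) ^ m := by
    intro m
    induction m with
    | zero => simp
    | succ m ih =>
      intro j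
      rw [← hDx, pi_eq_sum_univ' (x : P n), map_sum, Finset.sum_apply, pow_succ]
      refine Ideal.sum_mem _ fun i _ ↦ ?_
      rw [map_smul, Pi.smul_apply, smul_eq_mul]
      exact Ideal.mul_mem_mul (ih i) (mem_span_ρ_iff.2 (aug_of_mem_Omega2 (hD _) j))
  ext j : 2
  have := key k j
  rw [hk] at this
  simpa using this

/-- `Ω² 𝔽₂` has no nonzero projective direct summand. -/
theorem eq_bot_of_projective (Q : Submodule (GroupAlg n) (Omega2 n))
    [hQ : Module.Projective (GroupAlg n) Q] : Q = ⊥ := by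
  set J := Ideal.span (Set.range (ρ : Fin n → GroupAlg n)) with hJ
  obtain ⟨s, hs⟩ := Module.projective_def.1 hQ
  have hsocle : ∀ x : Q, socle n • x = 0 := fun x ↦ by
    ext j : 3
    simp only [Submodule.coe_smul, Pi.smul_apply, smul_eq_mul]
    rw [mul_comm]
    exact mul_socle_eq_zero_iff.2 (aug_of_mem_Omega2 x.1.2 j)
  -- Embed `Q` in a free module by the section `s`. The socle element kills `Q`, hence kills all
  -- coordinates, so these lie in `J` and `Q = JQ`.
  have htop : (⊤ : Submodule (GroupAlg n) Q) ≤ J • ⊤ := fun x _ ↦ by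
    rw [← hs x, Finsupp.linearCombination_apply]
    refine Submodule.sum_mem _ fun q _ ↦ Submodule.smul_mem_smul ?_ trivial
    rw [hJ, mem_span_ρ_iff, ← mul_socle_eq_zero_iff, mul_comm]
    have := congrArg (fun t ↦ t q) (s.map_smul (socle n) x)
    simpa [hsocle] using this.symm
  have hpow : ∀ k : ℕ, (⊤ : Submodule (GroupAlg n) Q) ≤ J ^ k • ⊤ := by
    intro k
    induction k with
    | zero => simp
    | succ k ih =>
      rw [pow_succ, Submodule.mul_smul]
      exact ih.trans (Submodule.smul_mono le_rfl htop)
  obtain ⟨k, hk⟩ := isNilpotent_span_ρ (n := n)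
  rw [eq_bot_iff]
  intro x hx
  have := hpow k (x := ⟨x, hx⟩) trivial
  rw [hk] at this
  simpa using this

/-! ### The middle term -/

/-- The embedding of the trivial module onto the socle of the group algebra. -/
theorem exists_socleHom (n : ℕ) :
    ∃ S : TrivF2 n →ₗ[GroupAlg n] GroupAlg n, S (one n) = socle n ∧ Function.Injective S := by
  obtain ⟨S, hS⟩ := exists_linearMap_triv (n := n) ρ_smul_socle
  refine ⟨S, hS, ?_⟩
  rw [injective_iff_map_eq_zero]
  intro x hx
  refine (eq_zero_or_one x).resolve_right ?_
  rintro rfl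
  exact socle_ne_zero (hS ▸ hx)

theorem ψ_a (n : ℕ) [NeZero n] : ψ n (a n) = socle n := by
  rw [ψ_apply, Finset.sum_eq_single 0 (fun i _ hi ↦ by simp [a, gen, hi]) (by simp), socle,
    ← Finset.prod_erase_mul _ _ (Finset.mem_univ (0 : Fin n))]
  simp [a, gen]

theorem a_notMem (n : ℕ) [NeZero n] : a n ∉ Omega2 n := by
  rw [Omega2, LinearMap.mem_ker, ψ_a]
  exact socle_ne_zero

theorem smul_a_mem [NeZero n] {c : GroupAlg n} : c • a n ∈ Omega2 n ↔ aug n c = 0 := by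
  rw [Omega2, LinearMap.mem_ker, map_smul, ψ_a, smul_eq_mul, mul_socle_eq_zero_iff]

/-- The submodule `Ω² 𝔽₂ + 𝔽₂ a`, as the preimage of the socle of `𝔽₂E` under `ψ`. -/
noncomputable def middle (n : ℕ) : Submodule (GroupAlg n) (P n) :=
  (Submodule.span (GroupAlg n) {socle n}).comap (ψ n)

theorem Omega2_le_middle : Omega2 n ≤ middle n := fun x hx ↦ by
  rw [middle, Submodule.mem_comap, LinearMap.mem_ker.1 hx]
  exact Submodule.zero_mem _

theorem a_mem_middle [NeZero n] : a n ∈ middle n := by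
  rw [middle, Submodule.mem_comap, ψ_a]
  exact Submodule.mem_span_singleton_self _

theorem exists_of_mem_middle [NeZero n] {x : P n} (hx : x ∈ middle n) :
    ∃ y ∈ Omega2 n, ∃ c : ZMod 2, x = y + c • a n := by
  obtain ⟨c, hc⟩ := Submodule.mem_span_singleton.1 (Submodule.mem_comap.1 hx)
  refine ⟨x - aug n c • a n, ?_, aug n c, (sub_add_cancel _ _).symm⟩
  rw [Omega2, LinearMap.mem_ker, map_sub, ← hc, ← algebraMap_smul (GroupAlg n) (aug n c), map_smul,
    ψ_a, smul_eq_aug_smul ρ_smul_socle, sub_self]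

theorem middle_restrictScalars [NeZero n] :
    (middle n).restrictScalars (ZMod 2) =
      (Omega2 n).restrictScalars (ZMod 2) ⊔ Submodule.span (ZMod 2) {a n} := by
  refine le_antisymm (fun x hx ↦ ?_) (sup_le (fun x hx ↦ Omega2_le_middle hx) ?_)
  · obtain ⟨y, hy, c, rfl⟩ := exists_of_mem_middle hx
    exact Submodule.add_mem_sup hy (Submodule.smul_mem _ _ (Submodule.mem_span_singleton_self _))
  · rw [Submodule.span_singleton_le_iff_mem]
    exact a_mem_middle

/-- A linear map on `Ω² 𝔽₂` extends to `Ω² 𝔽₂ + 𝔽₂ a` once a compatible image of `a` is given. -/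
theorem exists_extend_middle [NeZero n] {Z : Type*} [AddCommGroup Z] [Module (GroupAlg n) Z]
    (φ : Omega2 n →ₗ[GroupAlg n] Z) (z : Z)
    (hz : ∀ i : Fin n, φ ⟨(ρ i : GroupAlg n) • a n, smul_a_mem.2 (aug_ρ i)⟩ =
      (ρ i : GroupAlg n) • z) :
    ∃ φ' : middle n →ₗ[GroupAlg n] Z,
      (∀ x, φ' (Submodule.inclusion Omega2_le_middle x) = φ x) ∧ φ' ⟨a n, a_mem_middle⟩ = z := by
  let p : (Omega2 n × GroupAlg n) →ₗ[GroupAlg n] middle n :=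
    (Submodule.inclusion Omega2_le_middle).coprod
      (LinearMap.toSpanSingleton (GroupAlg n) (middle n) ⟨a n, a_mem_middle⟩)
  have hp : Function.Surjective p := fun ⟨x, hx⟩ ↦ by
    obtain ⟨y, hy, c, rfl⟩ := exists_of_mem_middle hx
    refine ⟨(⟨y, hy⟩, algebraMap (ZMod 2) _ c), ?_⟩
    ext1
    simp only [p, LinearMap.coprod_apply, LinearMap.toSpanSingleton_apply, Submodule.coe_add,
      Submodule.coe_inclusion, algebraMap_smul]
    rfl
  -- `Γ` is the graph of `φ`, with the value first. By `hz` the class of `(z, a)` modulo `Γ` is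
  -- killed by every `ρ i`, hence by `J`; so `c • a ∈ Ω²` forces `φ (c • a) = c • z`.
  let Γ := LinearMap.range (φ.prod (Omega2 n).subtype)
  obtain ⟨φ', hφ'⟩ := LinearMap.exists_comp_eq_of_surjective p hp
    (φ.coprod (LinearMap.toSpanSingleton (GroupAlg n) Z z)) (by
      rintro ⟨y, c⟩ hy
      have hy0 : (y : P n) + c • a n = 0 := congrArg Subtype.val (LinearMap.mem_ker.1 hy)
      have hca : c • a n = -(y : P n) := eq_neg_of_add_eq_zero_right hy0
      have hc : aug n c = 0 := smul_a_mem.1 (hca ▸ neg_mem y.2)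
      have h0 : c • Γ.mkQ (z, a n) = 0 := smul_eq_zero_of_aug (fun i ↦ by
        rw [← map_smul, Submodule.mkQ_apply, Submodule.Quotient.mk_eq_zero]
        exact ⟨_, Prod.ext (hz i) rfl⟩) hc
      rw [← map_smul, Submodule.mkQ_apply, Submodule.Quotient.mk_eq_zero] at h0
      obtain ⟨y', hy'⟩ := h0
      have h1 : φ y' = c • z := congrArg Prod.fst hy'
      have h2 : (y' : P n) = c • a n := congrArg Prod.snd hy'
      have h3 : y' = -y := Subtype.ext (h2.trans hca)
      rw [LinearMap.mem_ker, LinearMap.coprod_apply, LinearMap.toSpanSingleton_apply, ← h1, h3,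
        map_neg, add_neg_cancel])
  refine ⟨φ', fun x ↦ ?_, ?_⟩
  · simpa [p] using hφ' (x, 0)
  · simpa [p] using hφ' (0, 1)

/-! ### Families of maps into the group algebra -/

/-- Multiplication by all the `ρ i` at once. -/
noncomputable def ρMap (n : ℕ) (X : Type*) [AddCommGroup X] [Module (GroupAlg n) X] :
    X →ₗ[GroupAlg n] (Fin n → X) :=
  LinearMap.pi fun i ↦ (ρ i : GroupAlg n) • LinearMap.id

theorem ρMap_apply {X : Type*} [AddCommGroup X] [Module (GroupAlg n) X] (x : X) (i : Fin n) :
    ρMap n X x i = (ρ i : GroupAlg n) • x := rfl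

/-- The map into `P` with components `x ↦ w (x at position i)`. -/
noncomputable def toP {X : Type*} [AddCommGroup X] [Module (GroupAlg n) X]
    (w : (Fin n → X) →ₗ[GroupAlg n] GroupAlg n) : X →ₗ[GroupAlg n] P n :=
  LinearMap.pi fun i ↦ w ∘ₗ LinearMap.single (GroupAlg n) (fun _ ↦ X) i

theorem sum_toP {X : Type*} [AddCommGroup X] [Module (GroupAlg n) X]
    (w : (Fin n → X) →ₗ[GroupAlg n] GroupAlg n) (y : Fin n → X) :
    ∑ i, toP w (y i) i = w y := by
  conv_rhs => rw [← Finset.univ_sum_single y, map_sum]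
  rfl

/-- Hence `toP w` lands in `Ω²` when `w` vanishes on the image of `ρMap`, and in the middle term
when `w` sends that image into the socle. -/
theorem ψ_toP {X : Type*} [AddCommGroup X] [Module (GroupAlg n) X]
    (w : (Fin n → X) →ₗ[GroupAlg n] GroupAlg n) (x : X) :
    ψ n (toP w x) = w (ρMap n X x) := by
  rw [ψ_apply, ← sum_toP w]
  refine Finset.sum_congr rfl fun i _ ↦ ?_
  rw [ρMap_apply, map_smul, Pi.smul_apply, smul_eq_mul, mul_comm]

/-! ### The Auslander–Reiten sequence -/

theorem exists_η (n : ℕ) [NeZero n] : ∃ η : middle n →ₗ[GroupAlg n] TrivF2 n,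
    (∀ x, η (Submodule.inclusion Omega2_le_middle x) = 0) ∧
      η ⟨a n, a_mem_middle⟩ = one n :=
  exists_extend_middle 0 (one n) fun i ↦ (ρ_smul_triv i _).symm

section

variable [NeZero n] {η : middle n →ₗ[GroupAlg n] TrivF2 n}

theorem comp_η (hΩ : ∀ x, η (Submodule.inclusion Omega2_le_middle x) = 0)
    (ha : η ⟨a n, a_mem_middle⟩ = one n) {S : TrivF2 n →ₗ[GroupAlg n] GroupAlg n}
    (hS : S (one n) = socle n) (x : middle n) : S (η x) = ψ n x := by
  obtain ⟨x, hx⟩ := x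
  obtain ⟨y, hy, c, rfl⟩ := exists_of_mem_middle hx
  have : (⟨y + c • a n, hx⟩ : middle n) = Submodule.inclusion Omega2_le_middle ⟨y, hy⟩ +
      algebraMap (ZMod 2) (GroupAlg n) c • ⟨a n, a_mem_middle⟩ := by
    ext1
    simp only [Submodule.coe_add, Submodule.coe_inclusion, algebraMap_smul]
    rfl
  rw [this, map_add, hΩ, zero_add, map_smul, ha, map_smul, hS]
  simp only [Submodule.coe_add, Submodule.coe_inclusion, Submodule.coe_smul, map_add, map_smul,
    ψ_a]
  rw [LinearMap.mem_ker.1 hy, zero_add]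

theorem exists_lift_of_not_split (hΩ : ∀ x, η (Submodule.inclusion Omega2_le_middle x) = 0)
    (ha : η ⟨a n, a_mem_middle⟩ = one n) {X : Type*} [AddCommGroup X] [Module (GroupAlg n) X]
    (φ : X →ₗ[GroupAlg n] TrivF2 n)
    (hφ : ¬ ∃ s : TrivF2 n →ₗ[GroupAlg n] X, φ ∘ₗ s = LinearMap.id) :
    ∃ φ' : X →ₗ[GroupAlg n] middle n, η ∘ₗ φ' = φ := by
  obtain ⟨S, hS, hSinj⟩ := exists_socleHom n
  obtain ⟨w, hw⟩ := MonoidAlgebra.exists_comp_eq_of_ker_le (ρMap n X) (S ∘ₗ φ) (fun x hx ↦ by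
    rw [LinearMap.mem_ker, LinearMap.comp_apply]
    rcases eq_zero_or_one (φ x) with h | h
    · rw [h, map_zero]
    -- An `x` killed by all `ρ i` with `φ x = 1` would define a section of `φ`.
    · obtain ⟨s, hs⟩ := exists_linearMap_triv (n := n) (x := x) fun i ↦ congrFun hx i
      exact absurd ⟨s, triv_linearMap_ext (by simp [hs, h])⟩ hφ)
  have hmem : ∀ x, toP w x ∈ middle n := fun x ↦ by
    rw [middle, Submodule.mem_comap, ψ_toP, hw, LinearMap.comp_apply]
    rcases eq_zero_or_one (φ x) with h | h
    · rw [h, map_zero]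
      exact Submodule.zero_mem _
    · rw [h, hS]
      exact Submodule.mem_span_singleton_self _
  refine ⟨(toP w).codRestrict _ hmem, LinearMap.ext fun x ↦ hSinj ?_⟩
  rw [LinearMap.comp_apply, comp_η hΩ ha hS, LinearMap.codRestrict_apply, ψ_toP, hw,
    LinearMap.comp_apply]

theorem exists_extend_of_not_split {X : Type*} [AddCommGroup X] [Module (GroupAlg n) X]
    (φ : Omega2 n →ₗ[GroupAlg n] X)
    (hφ : ¬ ∃ s : X →ₗ[GroupAlg n] Omega2 n, s ∘ₗ φ = LinearMap.id) :
    ∃ φ' : middle n →ₗ[GroupAlg n] X, φ' ∘ₗ Submodule.inclusion Omega2_le_middle = φ := by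
  let b : Fin n → Omega2 n := fun i ↦ ⟨(ρ i : GroupAlg n) • a n, smul_a_mem.2 (aug_ρ i)⟩
  let y : Fin n → X := fun i ↦ φ (b i)
  by_cases hy : y ∈ LinearMap.range (ρMap n X)
  · obtain ⟨z, hz⟩ := hy
    obtain ⟨φ', h, -⟩ := exists_extend_middle φ z fun i ↦ (congrFun hz i).symm
    exact ⟨φ', LinearMap.ext h⟩
  refine absurd ?_ hφ
  obtain ⟨S, hS, -⟩ := exists_socleHom n
  let π := (LinearMap.range (ρMap n X)).mkQ
  have hπ : ∀ x, π x = 0 ↔ x ∈ LinearMap.range (ρMap n X) := fun x ↦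
    Submodule.Quotient.mk_eq_zero _
  -- The class of `y` is a socle element of the quotient: `ρₖ φ(ρᵢa) = ρᵢ φ(ρₖa)`, so `ρₖ y` is
  -- `ρMap` applied to `φ (b k)`.
  obtain ⟨j, hj⟩ := exists_linearMap_triv (n := n) (x := π y) fun i ↦ by
    rw [← map_smul, hπ]
    refine ⟨φ (b i), funext fun k ↦ ?_⟩
    rw [ρMap_apply, Pi.smul_apply, ← map_smul, ← map_smul]
    congr 1
    ext1
    exact smul_comm _ _ _
  obtain ⟨w, hw⟩ := MonoidAlgebra.exists_comp_eq_of_ker_le j S (fun x hx ↦ by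
    rcases eq_zero_or_one x with rfl | rfl
    · exact map_zero _
    · exact absurd ((hπ y).1 (hj ▸ hx)) hy)
  have hwy : (w ∘ₗ π) y = socle n := by
    rw [LinearMap.comp_apply, ← hj, hw, hS]
  have hmem : ∀ x, toP (w ∘ₗ π) x ∈ Omega2 n := fun x ↦ by
    rw [Omega2, LinearMap.mem_ker, ψ_toP, LinearMap.comp_apply, (hπ _).2 ⟨x, rfl⟩, map_zero]
  let t : X →ₗ[GroupAlg n] Omega2 n := (toP (w ∘ₗ π)).codRestrict _ hmem
  obtain ⟨F, c, hF, hc⟩ := exists_extension (t ∘ₗ φ)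
  -- Both sides equal `ψ (F a) = ∑ ρᵢ (F a)ᵢ = ∑ (F (ρᵢa))ᵢ = ∑ (t yᵢ)ᵢ`, and the last sum is the
  -- value of `w ∘ π` at `y`.
  have h1 : c * socle n = socle n := by
    rw [← ψ_a, ← hc, ψ_a, ψ_apply, ← hwy, ← sum_toP]
    refine Finset.sum_congr rfl fun i _ ↦ ?_
    have : F ((ρ i : GroupAlg n) • a n) = toP (w ∘ₗ π) (y i) := hF (b i)
    rw [← this, map_smul, Pi.smul_apply, smul_eq_mul, mul_comm]
  have h2 : aug n c = 1 := (aug_eq_zero_or_one c).resolve_left fun h ↦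
    socle_ne_zero (h1 ▸ mul_socle_eq_zero_iff.2 h)
  have hinj := injective_of_aug_eq_one hF hc h2
  let e := LinearEquiv.ofBijective (t ∘ₗ φ) ⟨hinj, Finite.surjective_of_injective hinj⟩
  exact ⟨e.symm.toLinearMap ∘ₗ t, LinearMap.ext fun x ↦ e.symm_apply_apply x⟩

theorem isAuslanderReitenSequence (hΩ : ∀ x, η (Submodule.inclusion Omega2_le_middle x) = 0)
    (ha : η ⟨a n, a_mem_middle⟩ = one n) :
    IsAuslanderReitenSequence.{u} (Submodule.inclusion (Omega2_le_middle (n := n))) η where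
  injective := Submodule.inclusion_injective _
  exact x := by
    refine ⟨fun h ↦ ?_, ?_⟩
    · obtain ⟨S, hS, -⟩ := exists_socleHom n
      refine ⟨⟨x, ?_⟩, rfl⟩
      rw [Omega2, LinearMap.mem_ker, ← comp_η hΩ ha hS, h, map_zero]
    · rintro ⟨y, rfl⟩
      exact hΩ y
  surjective x := by
    rcases eq_zero_or_one x with rfl | rfl
    · exact ⟨0, map_zero _⟩
    · exact ⟨_, ha⟩
  not_split := by
    rintro ⟨s, hs⟩
    have h1 : η (s (one n)) = one n := LinearMap.congr_fun hs _
    -- A section would send `1` into the socle of `P`, which lies in `Ω² = ker η`.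
    have h2 : (s (one n) : P n) ∈ Omega2 n := mem_Omega2_of_ρ_smul_eq_zero fun i ↦ by
      rw [← Submodule.coe_smul, ← map_smul, ρ_smul_triv, map_zero, Submodule.coe_zero]
    exact one_ne_zero (h1.symm.trans (hΩ ⟨_, h2⟩))
  left_almost_split _ _ _ φ hφ := exists_extend_of_not_split φ hφ
  right_almost_split _ _ _ φ hφ := exists_lift_of_not_split hΩ ha φ hφ

end

/-! ### Computation of `Ext¹(𝔽₂, Ω² 𝔽₂)` -/

instance injective_P : Module.Injective (GroupAlg n) (P n) where
  out X Y _ _ _ _ f hf q := by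
    choose w hw using fun i : Fin n ↦ MonoidAlgebra.exists_comp_eq_of_ker_le f
      (LinearMap.proj i ∘ₗ q) (by rw [LinearMap.ker_eq_bot.2 hf]; exact bot_le)
    exact ⟨LinearMap.pi w, fun x ↦ funext fun i ↦ hw i x⟩

/-- Homomorphisms from the trivial module to the image of `ψ`. -/
theorem bijective_coeff_eval [NeZero n] : Function.Bijective
    fun f : TrivF2 n →ₗ[GroupAlg n] LinearMap.range (ψ n) ↦ (f (one n) : GroupAlg n).coeff 1 := by
  constructor
  · intro f g hfg
    refine triv_linearMap_ext (Subtype.ext (MonoidAlgebra.ext (Finsupp.ext fun x ↦ ?_)))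
    have key : ∀ (h : TrivF2 n →ₗ[GroupAlg n] LinearMap.range (ψ n)) (i : Fin n),
        (ρ i : GroupAlg n) • (h (one n) : GroupAlg n) = 0 := fun h i ↦ by
      rw [← Submodule.coe_smul, ← map_smul, ρ_smul_triv, map_zero, Submodule.coe_zero]
    rw [coeff_eq_of_ρ_smul (key f), coeff_eq_of_ρ_smul (key g)]
    exact hfg
  · intro c
    rcases (by decide : ∀ y : ZMod 2, y = 0 ∨ y = 1) c with rfl | rfl
    · exact ⟨0, by simp⟩
    · obtain ⟨f, hf⟩ := exists_linearMap_triv (n := n)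
        (x := (⟨socle n, a n, ψ_a n⟩ : LinearMap.range (ψ n)))
        fun i ↦ Subtype.ext (ρ_smul_socle i)
      exact ⟨f, by simp only [hf, socle_coeff]⟩

/-- The short exact sequence `0 → Ω² 𝔽₂ → P → im ψ → 0`. -/
noncomputable def syzygySequence (n : ℕ) : ShortComplex (ModuleCat.{0} (GroupAlg n)) :=
  ShortComplex.mk (ModuleCat.ofHom (Omega2 n).subtype) (ModuleCat.ofHom (ψ n).rangeRestrict) (by
    ext x : 3
    exact x.2)

theorem syzygySequence_shortExact (n : ℕ) : (syzygySequence n).ShortExact :=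
  ModuleCat.shortComplex_shortExact _
    (fun x ↦ ⟨fun h ↦ ⟨⟨x, congrArg Subtype.val h⟩, rfl⟩, by
      rintro ⟨y, rfl⟩
      exact Subtype.ext y.2⟩)
    Subtype.val_injective (ψ n).surjective_rangeRestrict

/-- `Ext¹(𝔽₂, Ω² 𝔽₂)` is `𝔽₂`. -/
theorem nonempty_ext_equiv [NeZero n] :
    Nonempty (Abelian.Ext (ModuleCat.of (GroupAlg n) (TrivF2 n))
      (ModuleCat.of (GroupAlg n) (Omega2 n)) 1 ≃ₗ[ZMod 2] ZMod 2) := by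
  have hS := syzygySequence_shortExact n
  let T := ModuleCat.of (GroupAlg n) (TrivF2 n)
  let ev : (T ⟶ (syzygySequence n).X₃) →+ ZMod 2 :=
    { toFun := fun f ↦ (Subtype.val (p := (· ∈ LinearMap.range (ψ n))) (f.hom (one n))).coeff 1
      map_zero' := rfl
      map_add' := fun f g ↦ rfl }
  let δ : (T ⟶ (syzygySequence n).X₃) →+ Abelian.Ext T (syzygySequence n).X₁ 1 :=
    (hS.extClass.postcomp T (zero_add 1)).comp Abelian.Ext.addEquiv₀.symm.toAddMonoidHom
  have hev : Function.Bijective ev :=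
    (bijective_coeff_eval (n := n)).comp (ModuleCat.homEquiv).bijective
  -- `δ` is injective because every map `𝔽₂ → P` lands in the socle of `P`, hence in `ker ψ`. It is
  -- surjective because `P` is injective, so `Ext¹(𝔽₂, P) = 0`.
  have hδ : Function.Bijective δ := by
    constructor
    · rw [injective_iff_map_eq_zero]
      intro f hf
      obtain ⟨x₂, hx₂⟩ := Abelian.Ext.covariant_sequence_exact₃ T hS _ (zero_add 1) hf
      obtain ⟨g, rfl⟩ := Abelian.Ext.addEquiv₀.symm.surjective x₂
      have hfg : f = g ≫ (syzygySequence n).g := by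
        apply Abelian.Ext.addEquiv₀.symm.injective
        refine hx₂.symm.trans ?_
        simp
      let g' : TrivF2 n →ₗ[GroupAlg n] P n := g.hom
      have hg : g' (one n) ∈ Omega2 n := mem_Omega2_of_ρ_smul_eq_zero fun i ↦ by
        rw [← map_smul, ρ_smul_triv, map_zero]
      rw [hfg]
      refine ModuleCat.hom_ext (triv_linearMap_ext ?_)
      exact Subtype.ext hg
    · intro x
      have : Injective (syzygySequence n).X₂ :=
        Module.injective_object_of_injective_module (GroupAlg n) (P n)
      obtain ⟨x₃, hx₃⟩ := Abelian.Ext.covariant_sequence_exact₁ T hS x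
        (Abelian.Ext.eq_zero_of_injective _) (zero_add 1)
      exact ⟨Abelian.Ext.addEquiv₀ x₃, by simpa [δ] using hx₃⟩
  let e := (AddEquiv.ofBijective δ hδ).symm.trans (AddEquiv.ofBijective ev hev)
  -- Additive maps between `𝔽₂`-vector spaces are automatically linear.
  exact ⟨LinearEquiv.ofBijective (e.toAddMonoidHom.toZModLinearMap 2) e.bijective⟩

end ElemAbelian

theorem mainTheorem4 (n : ℕ) [NeZero n] :
    -- `Ω² 𝔽₂ = ker ψ` is the second syzygy of `𝔽₂`: `P → 𝔽₂E → 𝔽₂ → 0` is exact,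
    -- and `ker ψ` has no nonzero projective direct summand
    (Function.Exact (ElemAbelian.ψ n) (ElemAbelian.augmentation n) ∧
      Function.Surjective (ElemAbelian.augmentation n) ∧
      ∀ Q Q' : Submodule (ElemAbelian.GroupAlg n) (ElemAbelian.Omega2 n), IsCompl Q Q' →
        Module.Projective (ElemAbelian.GroupAlg n) Q → Q = ⊥) ∧
    -- `Ext¹(𝔽₂, Ω² 𝔽₂) = 𝔽₂`
    Nonempty (Abelian.Ext (ModuleCat.of (ElemAbelian.GroupAlg n) (ElemAbelian.TrivF2 n))
      (ModuleCat.of (ElemAbelian.GroupAlg n) (ElemAbelian.Omega2 n)) 1 ≃ₗ[ZMod 2] ZMod 2) ∧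
    -- `a` is not in `Ω² 𝔽₂`, and `M = Ω² 𝔽₂ + 𝔽₂ a` is an `𝔽₂E`-submodule of `P`
    ElemAbelian.a n ∉ ElemAbelian.Omega2 n ∧
    ∃ M : Submodule (ElemAbelian.GroupAlg n) (ElemAbelian.P n),
      M.restrictScalars (ZMod 2) =
        (ElemAbelian.Omega2 n).restrictScalars (ZMod 2) ⊔
          Submodule.span (ZMod 2) {ElemAbelian.a n} ∧
      -- there is an `𝔽₂E`-linear `η : M → 𝔽₂` with `η (Ω² 𝔽₂) = 0` and `η a = 1`
      ∃ (hΩ : ElemAbelian.Omega2 n ≤ M) (ha : ElemAbelian.a n ∈ M)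
        (η : M →ₗ[ElemAbelian.GroupAlg n] ElemAbelian.TrivF2 n),
        (∀ x : ElemAbelian.Omega2 n, η (Submodule.inclusion hΩ x) = 0) ∧
        η ⟨ElemAbelian.a n, ha⟩ = ElemAbelian.one n ∧
        -- `0 → Ω² 𝔽₂ → M → 𝔽₂ → 0` is an Auslander–Reiten sequence
        IsAuslanderReitenSequence.{u} (Submodule.inclusion hΩ) η ∧
        -- and every Auslander–Reiten sequence ending in `𝔽₂` is isomorphic to it
        ∀ (M' E' : Type u) [AddCommGroup M'] [Module (ElemAbelian.GroupAlg n) M']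
          [AddCommGroup E'] [Module (ElemAbelian.GroupAlg n) E']
          (α' : M' →ₗ[ElemAbelian.GroupAlg n] E')
          (β' : E' →ₗ[ElemAbelian.GroupAlg n] ElemAbelian.TrivF2 n),
          IsAuslanderReitenSequence.{u} α' β' →
          ∃ (f : ElemAbelian.Omega2 n ≃ₗ[ElemAbelian.GroupAlg n] M')
            (g : M ≃ₗ[ElemAbelian.GroupAlg n] E'),
            g.toLinearMap ∘ₗ Submodule.inclusion hΩ = α' ∘ₗ f.toLinearMap ∧
            β' ∘ₗ g.toLinearMap = η := by
  refine ⟨⟨ElemAbelian.exact_ψ_augmentation, ElemAbelian.augmentation_surjective,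
    fun Q _ _ hQ ↦ ElemAbelian.eq_bot_of_projective Q⟩, ElemAbelian.nonempty_ext_equiv,
    ElemAbelian.a_notMem n, ElemAbelian.middle n, ElemAbelian.middle_restrictScalars,
    ElemAbelian.Omega2_le_middle, ElemAbelian.a_mem_middle, ?_⟩
  obtain ⟨η, hΩ, ha⟩ := ElemAbelian.exists_η n
  refine ⟨η, hΩ, ha, ElemAbelian.isAuslanderReitenSequence hΩ ha, ?_⟩
  intro M' E' _ _ _ _ α' β' h
  exact IsAuslanderReitenSequence.exists_equiv
    (ElemAbelian.isAuslanderReitenSequence hΩ ha) (ElemAbelian.isAuslanderReitenSequence hΩ ha)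
    h h
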